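/- Let $L$ be a first-order signature (function and relation symbols of finite arity, constants and nullary relations allowed), and let $\mathcal K$ be a quasivariety of $L$-structures: a class of nonempty $L$-structures closed under isomorphism, substructures, direct products (including the empty product) and ultraproducts. A *congruence* of a structure $\mathbf A$ is a pair $\theta=\langle\theta_0,\theta_1\rangle$ in which $\theta_0$ is an equivalence relation on $A$ compatible with the operations, and $\theta_1=(\theta_1^R)_R$ assigns to each relation symbol $R$ of arity $n$ a set $\theta_1^R$ with $R^{\mathbf A}\subseteq\theta_1^R\subseteq A^n$ that is closed under componentwise $\theta_0$-equivalence. The quotient $\mathbf A/\theta$ has carrier $A/\theta_0$, with the induced operations and with relations induced by the $\theta_1^R$. A *$\mathcal K$-congruence* is a congruence $\theta$ with $\mathbf A/\theta\in\mathcal K$. Ordered by containment, the $\mathcal K$-congruences of $\mathbf A$ form a complete lattice $\operatorname{Con}_{\mathcal K}\mathbf A$ whose meets are intersections. For a set $S$ of atomic formulas $s\approx t$, $R(\mathbf s)$ with arguments in $A$, $\operatorname{con}_{\mathcal K}S$ denotes the least $\mathcal K$-congruence containing $S$, where $s\approx t$ belongs to $\theta$ if $(s,t)\in\theta_0$ and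 $R(\mathbf s)$ belongs to $\theta$ if $\mathbf s\in\theta_1^R$. Let $\mathbf F=\mathbf F_{\mathcal K}(\omega)$ be the $\mathcal K$-free structure on countably infinitely many generators, and let $\mathbf T$ be the join semilattice, with least element $0$, of compact elements of $\operatorname{Con}_{\mathcal K}\mathbf F$. Each endomorphism $\varepsilon$ of $\mathbf F$ induces a map $\widehat\varepsilon:\mathbf T\to\mathbf T$ preserving $\vee$ and $0$, determined by $\widehat\varepsilon(\operatorname{con}_{\mathcal K}(s\approx t))=\operatorname{con}_{\mathcal K}(\varepsilon s\approx\varepsilon t)$ and $\widehat\varepsilon(\operatorname{con}_{\mathcal K}R(\mathbf s))=\operatorname{con}_{\mathcal K}R(\varepsilon\mathbf s)$. Let $\mathbf S=\langle \mathbf T,\vee,0,\{\widehat\varepsilon:\varepsilon\in\operatorname{End}\mathbf F\}\rangle$, and let $\operatorname{Con}\mathbf S$ be the lattice of congruences of this algebra, i.e. of the equivalence relations on $\mathbf T$ compatible with $\vee$ and with every $\widehat\varepsilon$, ordered by inclusion. **Theorem.** The lattice $L_q(\mathcal K)$ of quasivarieties contained in $\mathcal K$, ordered by inclusion, is dually isomorphic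 to $\operatorname{Con}\mathbf S$. Equivalently, the lattice $\operatorname{QTh}(\mathcal K)$ of quasi-equational theories (sets of quasi-identities $\alpha_1\,\&\cdots\&\,\alpha_n\Rightarrow\beta$, with $n\ge 0$ and $\alpha_i,\beta$ atomic formulas, closed under logical consequence) containing the quasi-equational theory of $\mathcal K$, ordered by inclusion, is isomorphic to $\operatorname{Con}\mathbf S$. -/

import Mathlib

open FirstOrder FirstOrder.Language FirstOrder.Language.Structure CategoryTheory

universe u

namespace StructQV

/-! ### Atomic formulas, quasivarieties and quasi-equational theories -/

/-- Atomic formulas `a ≈ b` and `R(x₁, …, xₙ)` whose arguments are taken from `A`.  For `A` a set of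
terms these are the usual atomic formulas; for `A` a structure they are the data that a congruence
of `A` may contain. -/
inductive Atom (L : FirstOrder.Language.{u, u}) (A : Type u) : Type u
  | eq (a b : A) : Atom L A
  | rel {n : ℕ} (R : L.Relations n) (x : Fin n → A) : Atom L A

/-- Apply a map to all arguments of an atomic formula. -/
def Atom.map {L : FirstOrder.Language.{u, u}} {A B : Type u} (f : A → B) : Atom L A → Atom L B
  | .eq a b => .eq (f a) (f b)
  | .rel R x => .rel R (fun i => f (x i))

/-- Truth of an atomic formula in the structure from which its arguments are taken. -/
def Atom.Holds {L : FirstOrder.Language.{u, u}} {A : Type u} [L.Structure A] : Atom L A → Prop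
  | .eq a b => a = b
  | .rel R x => RelMap R x

/-- The direct product of a family of structures, with coordinatewise operations and relations. -/
instance piStructure {L : FirstOrder.Language.{u, u}} {I : Type u} (A : I → Type u)
    [∀ i, L.Structure (A i)] : L.Structure (∀ i, A i) where
  funMap f x := fun i => funMap f (fun k => x k i)
  RelMap R x := ∀ i, RelMap R (fun k => x k i)

/-- A quasivariety of `L`-structures: a class of (nonempty) structures closed under isomorphism,
substructures, direct products (the empty product included) and ultraproducts. -/
structure Quasivariety (L : FirstOrder.Language.{u, u}) where
  carrier : Set (Bundled.{u} L.Structure)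
  nonempty_of_mem : ∀ A ∈ carrier, Nonempty A
  iso_mem : ∀ A ∈ carrier, ∀ B : Bundled.{u} L.Structure, Nonempty (A ≃[L] B) → B ∈ carrier
  sub_mem : ∀ A ∈ carrier, ∀ S : L.Substructure A, Nonempty S →
    (Bundled.of S : Bundled.{u} L.Structure) ∈ carrier
  prod_mem : ∀ (I : Type u) (A : I → Bundled.{u} L.Structure), (∀ i, A i ∈ carrier) →
    (Bundled.of (∀ i, A i) : Bundled.{u} L.Structure) ∈ carrier
  ultraproduct_mem : ∀ (I : Type u) (U : Ultrafilter I) (A : I → Bundled.{u} L.Structure),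
    (∀ i, A i ∈ carrier) →
    (Bundled.of ((U : Filter I).Product fun i => A i) : Bundled.{u} L.Structure) ∈ carrier

namespace Quasivariety

variable {L : FirstOrder.Language.{u, u}}

theorem carrier_injective :
    Function.Injective (Quasivariety.carrier : Quasivariety L → Set (Bundled.{u} L.Structure)) := by
  rintro ⟨⟩ ⟨⟩ h
  cases h
  rfl

/-- Quasivarieties are ordered by inclusion. -/
instance : PartialOrder (Quasivariety L) := PartialOrder.lift carrier carrier_injective

end Quasivariety

/-- The quasivarieties contained in `K`, ordered by inclusion. -/
abbrev Lq {L : FirstOrder.Language.{u, u}} (K : Quasivariety L) : Type (u + 1) :=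
  {Q : Quasivariety L // Q ≤ K}

/-- The terms in countably many variables. -/
abbrev Terms (L : FirstOrder.Language.{u, u}) : Type u := L.Term ℕ

/-- A quasi-identity `α₁ & … & αₙ ⟹ β` with `αᵢ`, `β` atomic formulas in countably many variables;
`n = 0` is allowed. -/
structure QuasiIdentity (L : FirstOrder.Language.{u, u}) where
  premises : List (Atom L (Terms L))
  conclusion : Atom L (Terms L)

/-- A structure satisfies a quasi-identity if it does so under every assignment of the variables. -/
def QuasiIdentity.Sat {L : FirstOrder.Language.{u, u}} (q : QuasiIdentity L) (A : Type u) [L.Structure A] :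
    Prop :=
  ∀ v : ℕ → A, (∀ α ∈ q.premises, (α.map (Term.realize v)).Holds) →
    (q.conclusion.map (Term.realize v)).Holds

/-- The set of quasi-identities that hold throughout a quasivariety. -/
def Quasivariety.theory {L : FirstOrder.Language.{u, u}} (K : Quasivariety L) : Set (QuasiIdentity L) :=
  {q | ∀ A ∈ K.carrier, q.Sat A}

/-- A quasi-equational theory: a set of quasi-identities closed under logical consequence. -/
def IsQuasiEquationalTheory {L : FirstOrder.Language.{u, u}} (T : Set (QuasiIdentity L)) : Prop :=
  ∀ q : QuasiIdentity L,
    (∀ A : Bundled.{u} L.Structure, Nonempty A → (∀ p ∈ T, p.Sat A) → q.Sat A) → q ∈ T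

/-- `QTh K`: the quasi-equational theories containing the theory of `K`, ordered by inclusion. -/
abbrev QTh {L : FirstOrder.Language.{u, u}} (K : Quasivariety L) : Type u :=
  {T : Set (QuasiIdentity L) // IsQuasiEquationalTheory T ∧ K.theory ⊆ T}

/-! ### Congruences of structures -/

/-- A congruence `⟨θ₀, θ₁⟩` of a structure `A`: `θ₀` is an equivalence relation compatible with
the operations, and `θ₁` assigns to each relation symbol a relation containing the one of `A` and
compatible with `θ₀`. -/
structure StrCon (L : FirstOrder.Language.{u, u}) (A : Type u) [L.Structure A] where
  eqv : Setoid A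
  rel : ∀ {n : ℕ}, L.Relations n → Set (Fin n → A)
  fun_compat : ∀ {n : ℕ} (f : L.Functions n) (x y : Fin n → A),
    (∀ i, eqv (x i) (y i)) → eqv (funMap f x) (funMap f y)
  relMap_mem : ∀ {n : ℕ} (R : L.Relations n) (x : Fin n → A), RelMap R x → x ∈ rel R
  rel_compat : ∀ {n : ℕ} (R : L.Relations n) (x y : Fin n → A),
    (∀ i, eqv (x i) (y i)) → x ∈ rel R → y ∈ rel R

namespace StrCon

variable {L : FirstOrder.Language.{u, u}} {A B : Type u} [L.Structure A] [L.Structure B]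

/-- An atomic formula belongs to a congruence. -/
def Mem (θ : StrCon L A) : Atom L A → Prop
  | .eq a b => θ.eqv a b
  | .rel R x => x ∈ θ.rel R

/-- The set of atomic formulas belonging to a congruence. -/
def atoms (θ : StrCon L A) : Set (Atom L A) := {α | θ.Mem α}

theorem atoms_injective : Function.Injective (atoms : StrCon L A → Set (Atom L A)) := by
  rintro ⟨e, r, h1, h2, h3⟩ ⟨e', r', h1', h2', h3'⟩ h
  have he : e = e' := by
    ext a b
    exact Set.ext_iff.1 h (.eq a b)
  have hr : @r = @r' := by
    funext n R
    ext x
    exact Set.ext_iff.1 h (.rel R x)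
  subst he
  subst hr
  rfl

/-- Congruences are ordered by containment of both components. -/
instance : PartialOrder (StrCon L A) := PartialOrder.lift atoms atoms_injective

theorem le_iff {θ ψ : StrCon L A} : θ ≤ ψ ↔ ∀ α, θ.Mem α → ψ.Mem α := Iff.rfl

/-- The carrier of the quotient structure `A/θ`. -/
def Quot (θ : StrCon L A) : Type u := Quotient θ.eqv

/-- The canonical map to the quotient. -/
def proj (θ : StrCon L A) (a : A) : θ.Quot := Quotient.mk θ.eqv a

theorem proj_eq_proj {θ : StrCon L A} {a b : A} : θ.proj a = θ.proj b ↔ θ.eqv a b := Quotient.eq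

theorem proj_out (θ : StrCon L A) (q : θ.Quot) : θ.proj (Quotient.out q) = q := Quotient.out_eq q

theorem eqv_out (θ : StrCon L A) (a : A) : θ.eqv (Quotient.out (θ.proj a)) a :=
  proj_eq_proj.1 (proj_out θ (θ.proj a))

/-- The quotient structure: operations and relations are computed on representatives. -/
noncomputable instance quotStructure (θ : StrCon L A) : L.Structure θ.Quot where
  funMap f x := θ.proj (funMap f fun i => Quotient.out (x i))
  RelMap R x := (fun i => Quotient.out (x i)) ∈ θ.rel R

theorem funMap_proj (θ : StrCon L A) {n : ℕ} (f : L.Functions n) (x : Fin n → A) :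
    funMap f (fun i => θ.proj (x i)) = θ.proj (funMap f x) :=
  proj_eq_proj.2 (θ.fun_compat f _ _ fun i => θ.eqv_out (x i))

theorem relMap_proj (θ : StrCon L A) {n : ℕ} (R : L.Relations n) (x : Fin n → A) :
    RelMap R (fun i => θ.proj (x i)) ↔ x ∈ θ.rel R :=
  ⟨fun h => θ.rel_compat R _ _ (fun i => θ.eqv_out (x i)) h,
    fun h => θ.rel_compat R _ _ (fun i => θ.eqv.symm (θ.eqv_out (x i))) h⟩

/-- The canonical homomorphism from `A` onto `A/θ`. -/
def projHom (θ : StrCon L A) : A →[L] θ.Quot where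
  toFun := θ.proj
  map_fun' f x := (θ.funMap_proj f x).symm
  map_rel' R x h := (θ.relMap_proj R x).2 (θ.relMap_mem R x h)

theorem holds_proj (θ : StrCon L A) (α : Atom L A) : (α.map θ.proj).Holds ↔ θ.Mem α := by
  cases α with
  | eq a b => exact proj_eq_proj
  | rel R x => exact θ.relMap_proj R x

/-- The kernel of a homomorphism. -/
def ker (h : A →[L] B) : StrCon L A where
  eqv := Setoid.ker h
  rel R := {x | RelMap R (fun i => h (x i))}
  fun_compat f x y hxy := by
    change h (funMap f x) = h (funMap f y)
    rw [h.map_fun, h.map_fun]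
    exact congrArg _ (funext hxy)
  relMap_mem R x hx := h.map_rel R x hx
  rel_compat R x y hxy hx := by
    have : (fun i => h (x i)) = fun i => h (y i) := funext hxy
    change RelMap R _
    rw [← this]
    exact hx

theorem mem_ker (h : A →[L] B) (α : Atom L A) : (ker h).Mem α ↔ (α.map h).Holds := by
  cases α <;> exact Iff.rfl

/-- `A / ker h` embeds into `B`. -/
noncomputable def kerEmbedding (h : A →[L] B) : (ker h).Quot ↪[L] B where
  toFun q := h (Quotient.out q)
  inj' p q hpq := by
    rw [← proj_out _ p, ← proj_out _ q]
    exact proj_eq_proj.2 hpq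
  map_fun' f x :=
    Eq.trans ((ker h).eqv_out (funMap f fun i => Quotient.out (x i))) (h.map_fun f _)
  map_rel' R x := Iff.rfl

end StrCon

/-! ### The lattice of `K`-congruences -/

section KCon

variable {L : FirstOrder.Language.{u, u}} (K : Quasivariety L)

theorem Quasivariety.mem_of_embedding {A B : Type u} [L.Structure A] [L.Structure B] [Nonempty A]
    (hB : (Bundled.of B : Bundled.{u} L.Structure) ∈ K.carrier) (e : A ↪[L] B) :
    (Bundled.of A : Bundled.{u} L.Structure) ∈ K.carrier := by
  obtain ⟨a⟩ := ‹Nonempty A›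
  exact K.iso_mem _ (K.sub_mem _ hB e.toHom.range ⟨e.equivRange a⟩) _ ⟨e.equivRange.symm⟩

/-- The `K`-congruences of `A`: the congruences `θ` with `A/θ ∈ K`, ordered by containment. -/
abbrev KCon (A : Type u) [L.Structure A] : Type u :=
  {θ : StrCon L A // (Bundled.of θ.Quot : Bundled.{u} L.Structure) ∈ K.carrier}

variable {K} {A B : Type u} [L.Structure A] [L.Structure B]

/-- The kernel of a homomorphism into a member of `K` is a `K`-congruence. -/
def KCon.ker [Nonempty A] (hB : (Bundled.of B : Bundled.{u} L.Structure) ∈ K.carrier)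
    (h : A →[L] B) : KCon K A :=
  ⟨StrCon.ker h, by
    obtain ⟨a⟩ := ‹Nonempty A›
    have : Nonempty (StrCon.ker h).Quot := ⟨StrCon.proj _ a⟩
    exact K.mem_of_embedding hB (StrCon.kerEmbedding h)⟩

/-- The natural homomorphism from `A` to the product of its quotients by a set of congruences. -/
def toProd (s : Set (KCon K A)) : A →[L] (∀ θ : s, θ.1.1.Quot) where
  toFun a := fun θ => θ.1.1.proj a
  map_fun' f x := funext fun θ => (θ.1.1.funMap_proj f x).symm
  map_rel' R x h := fun θ => (θ.1.1.relMap_proj R x).2 (θ.1.1.relMap_mem R x h)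

/-- The intersection of a set of `K`-congruences, as the kernel of the map to the product. -/
noncomputable def KCon.inter [Nonempty A] (s : Set (KCon K A)) : KCon K A :=
  KCon.ker (K.prod_mem s (fun θ => Bundled.of θ.1.1.Quot) fun θ => θ.1.2) (toProd s)

theorem KCon.mem_inter [Nonempty A] (s : Set (KCon K A)) (α : Atom L A) :
    (KCon.inter s).1.Mem α ↔ ∀ θ ∈ s, θ.1.Mem α := by
  refine (StrCon.mem_ker (toProd s) α).trans ?_
  cases α with
  | eq a b =>
    constructor
    · intro h θ hθ
      exact StrCon.proj_eq_proj.1 (congrFun h ⟨θ, hθ⟩)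
    · intro h
      funext θ
      exact StrCon.proj_eq_proj.2 (h θ.1 θ.2)
  | rel R x =>
    constructor
    · intro h θ hθ
      exact (θ.1.relMap_proj R x).1 (h ⟨θ, hθ⟩)
    · intro h θ
      exact (θ.1.1.relMap_proj R x).2 (h θ.1 θ.2)

noncomputable instance [Nonempty A] : InfSet (KCon K A) := ⟨KCon.inter⟩

/-- The `K`-congruences of `A` form a complete lattice, in which meets are intersections. -/
noncomputable instance [Nonempty A] : CompleteLattice (KCon K A) :=
  completeLatticeOfInf (KCon K A) fun s =>
    ⟨fun θ hθ α hα => (KCon.mem_inter s α).1 hα θ hθ,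
      fun _ hψ α hα => (KCon.mem_inter s α).2 fun _ hθ => hψ hθ hα⟩

theorem KCon.le_iff [Nonempty A] {θ ψ : KCon K A} : θ ≤ ψ ↔ ∀ α, θ.1.Mem α → ψ.1.Mem α := Iff.rfl

theorem KCon.mem_sInf [Nonempty A] (s : Set (KCon K A)) (α : Atom L A) :
    (sInf s).1.Mem α ↔ ∀ θ ∈ s, θ.1.Mem α := KCon.mem_inter s α

/-- `con_K S`: the `K`-congruence generated by a set of atomic formulas. -/
noncomputable def conK [Nonempty A] (S : Set (Atom L A)) : KCon K A :=
  sInf {ψ | ∀ α ∈ S, ψ.1.Mem α}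

theorem conK_le [Nonempty A] {S : Set (Atom L A)} {ψ : KCon K A} :
    conK S ≤ ψ ↔ ∀ α ∈ S, ψ.1.Mem α :=
  ⟨fun h α hα => h ((KCon.mem_sInf _ α).2 fun _ hθ => hθ α hα), fun h => sInf_le h⟩

/-- The natural homomorphism from `A` to an ultraproduct of its quotients. -/
noncomputable def toUltra (s : Set (KCon K A)) (U : Ultrafilter s) :
    A →[L] ((U : Filter s).Product fun θ => θ.1.1.Quot) where
  toFun a := ((fun θ => θ.1.1.proj a : ∀ θ : s, θ.1.1.Quot) :
    (U : Filter s).Product fun θ => θ.1.1.Quot)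
  map_fun' f x := by
    refine Eq.trans ?_
      (Ultraproduct.funMap_cast (u := U) f (fun i (θ : s) => θ.1.1.proj (x i))).symm
    exact congrArg _ (funext fun θ => (θ.1.1.funMap_proj f x).symm)
  map_rel' R x h := by
    refine (relMap_quotient_mk' (ps := Ultraproduct.setoidPrestructure _ U) _ R
      (fun i (θ : s) => θ.1.1.proj (x i))).2 ?_
    exact Filter.Eventually.of_forall fun θ => (θ.1.1.relMap_proj R x).2 (θ.1.1.relMap_mem R x h)

theorem mem_ker_toUltra (s : Set (KCon K A)) (U : Ultrafilter s) (α : Atom L A) :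
    (StrCon.ker (toUltra s U)).Mem α ↔ ∀ᶠ θ in (U : Filter s), θ.1.1.Mem α := by
  refine (StrCon.mem_ker _ α).trans ?_
  cases α with
  | eq a b =>
    refine (Quotient.eq (r := (U : Filter s).productSetoid _)).trans ?_
    exact Filter.eventually_congr (Filter.Eventually.of_forall fun θ => StrCon.proj_eq_proj)
  | rel R x =>
    refine (relMap_quotient_mk' (ps := Ultraproduct.setoidPrestructure _ U) _ R
      (fun i (θ : s) => θ.1.1.proj (x i))).trans ?_
    exact Filter.eventually_congr (Filter.Eventually.of_forall fun θ => θ.1.1.relMap_proj R x)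

/-- Directed joins of `K`-congruences are unions. -/
theorem KCon.mem_sSup_of_directedOn [Nonempty A] {s : Set (KCon K A)} (hne : s.Nonempty)
    (hd : DirectedOn (· ≤ ·) s) (α : Atom L A) :
    (sSup s).1.Mem α ↔ ∃ θ ∈ s, θ.1.Mem α := by
  constructor
  · have : Nonempty s := hne.to_subtype
    have : IsDirected s (· ≤ ·) := ⟨fun a b => by
      obtain ⟨c, hc, h1, h2⟩ := hd a.1 a.2 b.1 b.2
      exact ⟨⟨c, hc⟩, h1, h2⟩⟩
    let U : Ultrafilter s := Ultrafilter.of Filter.atTop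
    have hU : (U : Filter s) ≤ Filter.atTop := Ultrafilter.of_le _
    let d : KCon K A := KCon.ker
      (K.ultraproduct_mem s U (fun θ => Bundled.of θ.1.1.Quot) fun θ => θ.1.2) (toUltra s U)
    have hd : sSup s ≤ d := sSup_le fun θ hθ β hβ =>
      (mem_ker_toUltra s U β).2
        (hU ((Filter.eventually_ge_atTop (⟨θ, hθ⟩ : s)).mono fun ψ hψ => hψ hβ))
    intro h
    obtain ⟨θ, hθ⟩ := ((mem_ker_toUltra s U α).1 (hd h)).exists
    exact ⟨θ.1, θ.2, hθ⟩
  · rintro ⟨θ, hθ, h⟩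
    exact le_sSup hθ h

/-- The extension of an endomorphism `ε` to all `K`-congruences: `φ` is sent to the `K`-congruence
generated by the images under `ε` of the atomic formulas in `φ`. -/
noncomputable def hat [Nonempty A] (ε : A →[L] A) (φ : KCon K A) : KCon K A :=
  conK (Atom.map ε '' φ.1.atoms)

/-- The inverse image of a `K`-congruence under an endomorphism. -/
noncomputable def KCon.comap [Nonempty A] (ε : A →[L] A) (θ : KCon K A) : KCon K A :=
  KCon.ker θ.2 (θ.1.projHom.comp ε)

theorem KCon.mem_comap [Nonempty A] (ε : A →[L] A) (θ : KCon K A) (α : Atom L A) :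
    (θ.comap ε).1.Mem α ↔ θ.1.Mem (α.map ε) := by
  refine (StrCon.mem_ker _ α).trans (Iff.trans ?_ (θ.1.holds_proj (α.map ε)))
  cases α <;> exact Iff.rfl

theorem hat_le [Nonempty A] {ε : A →[L] A} {φ θ : KCon K A} :
    hat ε φ ≤ θ ↔ φ ≤ θ.comap ε := by
  refine conK_le.trans ?_
  rw [Set.forall_mem_image]
  exact forall_congr' fun α => imp_congr Iff.rfl (KCon.mem_comap ε θ α).symm

theorem hat_gc [Nonempty A] (ε : A →[L] A) :
    GaloisConnection (hat ε : KCon K A → KCon K A) (KCon.comap ε) := fun _ _ => hat_le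

/-- On generators: `ε̂ (con_K S) = con_K (ε S)`. -/
theorem hat_conK [Nonempty A] (ε : A →[L] A) (S : Set (Atom L A)) :
    hat ε (conK S : KCon K A) = conK (Atom.map ε '' S) := by
  refine eq_of_forall_ge_iff fun θ => ?_
  rw [hat_le, conK_le, conK_le, Set.forall_mem_image]
  exact forall_congr' fun α => imp_congr Iff.rfl (KCon.mem_comap ε θ α)

theorem hat_isCompactElement [Nonempty A] (ε : A →[L] A) {φ : KCon K A}
    (hφ : IsCompactElement φ) : IsCompactElement (hat ε φ) := by
  rw [CompleteLattice.isCompactElement_iff_le_of_directed_sSup_le] at hφ ⊢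
  intro s hne hd hle
  rw [hat_le] at hle
  obtain ⟨ψ, ⟨θ, hθ, rfl⟩, h⟩ := hφ (KCon.comap ε '' s) (hne.image _)
    (by
      rintro _ ⟨a, ha, rfl⟩ _ ⟨b, hb, rfl⟩
      obtain ⟨c, hc, h1, h2⟩ := hd a ha b hb
      exact ⟨_, ⟨c, hc, rfl⟩, (hat_gc ε).monotone_u h1, (hat_gc ε).monotone_u h2⟩)
    (by
      refine hle.trans fun α hα => ?_
      obtain ⟨θ, hθ, h⟩ := (KCon.mem_sSup_of_directedOn hne hd _).1
        ((KCon.mem_comap ε _ α).1 hα)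
      exact (le_sSup (Set.mem_image_of_mem (KCon.comap ε) hθ) : θ.comap ε ≤ _)
        ((KCon.mem_comap ε θ α).2 h))
  exact ⟨θ, hθ, hat_le.2 h⟩

variable (K A)

/-- The compact elements of the lattice of `K`-congruences of `A`. -/
abbrev CompactKCon [Nonempty A] : Type u := {φ : KCon K A // IsCompactElement φ}

variable {K A}

theorem isCompactElement_sup [Nonempty A] {φ ψ : KCon K A} (hφ : IsCompactElement φ)
    (hψ : IsCompactElement ψ) : IsCompactElement (φ ⊔ ψ) := by
  intro s v hne hd hv hle
  obtain ⟨a, ha, h1⟩ := hφ s v hne hd hv (le_sup_left.trans hle)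
  obtain ⟨b, hb, h2⟩ := hψ s v hne hd hv (le_sup_right.trans hle)
  obtain ⟨c, hc, h3, h4⟩ := hd a ha b hb
  exact ⟨c, hc, sup_le (h1.trans h3) (h2.trans h4)⟩

theorem isCompactElement_bot [Nonempty A] : IsCompactElement (⊥ : KCon K A) :=
  fun _ _ ⟨a, ha⟩ _ _ _ => ⟨a, ha, bot_le⟩

noncomputable instance [Nonempty A] : SemilatticeSup (CompactKCon K A) :=
  Subtype.semilatticeSup fun _ _ => isCompactElement_sup

noncomputable instance [Nonempty A] : OrderBot (CompactKCon K A) :=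
  Subtype.orderBot isCompactElement_bot

/-- The operator `ε̂` on the join semilattice of compact `K`-congruences; it preserves `∨` and
`0`. -/
noncomputable def hatOp [Nonempty A] (ε : A →[L] A) :
    SupBotHom (CompactKCon K A) (CompactKCon K A) where
  toFun φ := ⟨hat ε φ.1, hat_isCompactElement ε φ.2⟩
  map_sup' _ _ := Subtype.ext ((hat_gc ε).l_sup)
  map_bot' := Subtype.ext ((hat_gc ε).l_bot)

end KCon

/-! ### The countably generated free structure -/

/-- The absolutely free structure on `ω`: terms, with all relations empty. -/
def TermStr (L : FirstOrder.Language.{u, u}) : Type u := Terms L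

instance (L : FirstOrder.Language.{u, u}) : L.Structure (TermStr L) where
  funMap f x := Term.func f x
  RelMap _ _ := False

instance (L : FirstOrder.Language.{u, u}) : Nonempty (TermStr L) := ⟨(Term.var 0 : L.Term ℕ)⟩

/-- `F_K(ω)`: the quotient of the absolutely free structure on `ω` by its least `K`-congruence. -/
def FreeStr {L : FirstOrder.Language.{u, u}} (K : Quasivariety L) : Type u :=
  (⊥ : KCon K (TermStr L)).1.Quot

section FreeStr

variable {L : FirstOrder.Language.{u, u}} (K : Quasivariety L)

noncomputable instance : L.Structure (FreeStr K) :=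
  inferInstanceAs (L.Structure (⊥ : KCon K (TermStr L)).1.Quot)

/-- The free generators. -/
noncomputable def FreeStr.gen (i : ℕ) : FreeStr K := StrCon.proj _ (Term.var i : L.Term ℕ)

instance : Nonempty (FreeStr K) := ⟨FreeStr.gen K 0⟩

/-- `F_K(ω)` belongs to `K`. -/
theorem freeStr_mem : (Bundled.of (FreeStr K) : Bundled.{u} L.Structure) ∈ K.carrier :=
  (⊥ : KCon K (TermStr L)).2

/-- The generators have the universal property with respect to `K`. -/
theorem freeStr_existsUnique {A : Type u} [L.Structure A]
    (hA : (Bundled.of A : Bundled.{u} L.Structure) ∈ K.carrier) (v : ℕ → A) :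
    ∃! h : FreeStr K →[L] A, ∀ i, h (FreeStr.gen K i) = v i := by
  let g : TermStr L →[L] A :=
    { toFun := fun t => Term.realize v (t : L.Term ℕ)
      map_fun' := fun _ _ => rfl
      map_rel' := fun _ _ h => h.elim }
  have hg : (⊥ : KCon K (TermStr L)) ≤ KCon.ker hA g := bot_le
  have hout : ∀ t : TermStr L,
      g (Quotient.out (StrCon.proj (⊥ : KCon K (TermStr L)).1 t)) = g t := fun t =>
    KCon.le_iff.1 hg (.eq _ t) (StrCon.eqv_out (⊥ : KCon K (TermStr L)).1 t)
  refine ⟨⟨fun q => g (Quotient.out q), ?_, ?_⟩, fun i => hout _, ?_⟩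
  · intro n f x
    exact (hout _).trans (g.map_fun f _)
  · intro n R x h
    exact KCon.le_iff.1 hg (.rel R _) h
  · intro h hh
    have key : ∀ t : L.Term ℕ, h (StrCon.proj _ t : FreeStr K) = Term.realize v t := by
      intro t
      induction t with
      | var i => exact hh i
      | func f ts ih =>
        have e := StrCon.funMap_proj (⊥ : KCon K (TermStr L)).1 f ts
        refine (congrArg h e.symm).trans ((h.map_fun f _).trans ?_)
        exact congrArg (funMap f) (funext ih)
    refine FirstOrder.Language.Hom.ext fun q => ?_
    have := key (Quotient.out q)
    refine Eq.trans ?_ this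
    exact congrArg h (StrCon.proj_out _ q).symm

end FreeStr

/-! ### Congruences of semilattices with operators -/

/-- A congruence of the algebra `⟨S, ∨, 0, (op i)ᵢ⟩`. -/
structure OpCon {S ι : Type u} [SemilatticeSup S] [OrderBot S] (op : ι → SupBotHom S S) where
  eqv : Setoid S
  sup_compat : ∀ a b c d : S, eqv a b → eqv c d → eqv (a ⊔ c) (b ⊔ d)
  op_compat : ∀ (i : ι) (a b : S), eqv a b → eqv (op i a) (op i b)

namespace OpCon

variable {S ι : Type u} [SemilatticeSup S] [OrderBot S] {op : ι → SupBotHom S S}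

theorem eqv_injective : Function.Injective (OpCon.eqv : OpCon op → Setoid S) := by
  rintro ⟨⟩ ⟨⟩ h
  cases h
  rfl

/-- Congruences are ordered by inclusion. -/
instance : PartialOrder (OpCon op) := PartialOrder.lift OpCon.eqv eqv_injective

end OpCon

/-- `Con S_K`, where `S_K = ⟨T, ∨, 0, {ε̂ : ε ∈ End F}⟩` with `F = F_K(ω)` and `T` the join
semilattice of compact `K`-congruences of `F`. -/
abbrev ConS {L : FirstOrder.Language.{u, u}} (K : Quasivariety L) : Type u :=
  OpCon (fun ε : FreeStr K →[L] FreeStr K => (hatOp ε : SupBotHom (CompactKCon K (FreeStr K)) _))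

end StructQV

namespace StructQV

section QuasiIdentities

variable {L : FirstOrder.Language.{u, u}}

/-! ### Atomic formulas and homomorphisms -/

/-! Finitely many atomic formulas in variables, read at the free generators of `F`, generate a
compact `K`-congruence, and every compact one arises so (`listCon_surjective`). A quasi-identity
thus becomes a pair of compact congruences, premises and conclusion, and a substitution becomes an
endomorphism of `F`. By freeness, `F/χ` satisfies it iff for every `ε` the image of the premises
under `ε̂` lies below `χ` only if the image of the conclusion does (`sat_quot_iff`).

A theory `T` yields the congruence of `S` identifying compact `φ`, `ψ` that lie below the same `χ`
with `F/χ` a model of `T`. Conversely, `θ` yields the quasi-identities whose conclusion is below the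
premises modulo `θ`. These maps are inverse because each `θ` has enough models: joining all compact
congruences that are below `φ` modulo `θ` gives `closure θ φ`. By compactness nothing else compact
gets below it (`le_closure_iff`), and its quotient satisfies the theory of `θ` because `θ` respects
the operators (`sat_closure`).

The dual isomorphism with subquasivarieties then follows from Mal'cev's theorem that a quasivariety
is the class of models of its quasi-identities (`modelClass_theory`). -/

theorem Atom.map_map {A B C : Type u} (g : B → C) (f : A → B) (α : Atom L A) :
    (α.map f).map g = α.map (g ∘ f) := by
  cases α <;> rfl

theorem Atom.holds_map_embedding {A B : Type u} [L.Structure A] [L.Structure B] (e : A ↪[L] B)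
    (α : Atom L A) : (α.map e).Holds ↔ α.Holds := by
  cases α with
  | eq a b => exact e.injective.eq_iff
  | rel R x => exact e.map_rel R x

theorem Atom.map_realize_hom {A B : Type u} [L.Structure A] [L.Structure B] (h : A →[L] B)
    (v : ℕ → A) (α : Atom L (Terms L)) :
    (α.map (Term.realize v)).map h = α.map (Term.realize (h ∘ v)) := by
  rw [Atom.map_map]
  congr 1
  funext t
  exact (HomClass.realize_term h).symm

/-! ### Preservation of quasi-identities -/

theorem QuasiIdentity.Sat.of_embedding {q : QuasiIdentity L} {A B : Type u} [L.Structure A]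
    [L.Structure B] (e : A ↪[L] B) (hB : q.Sat B) : q.Sat A := by
  have key : ∀ (v : ℕ → A) (α : Atom L (Terms L)),
      (α.map (Term.realize (e ∘ v))).Holds ↔ (α.map (Term.realize v)).Holds := fun v α => by
    rw [← Atom.holds_map_embedding e (α.map (Term.realize v))]
    exact (congrArg Atom.Holds (Atom.map_realize_hom e.toHom v α)).symm.to_iff
  intro v hv
  exact (key v _).1 (hB _ fun α hα => (key v α).2 (hv α hα))

/-- Evaluation of a coordinate in a direct product. -/
def piEval {I : Type u} (A : I → Type u) [∀ i, L.Structure (A i)] (i : I) :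
    (∀ i, A i) →[L] A i where
  toFun x := x i
  map_fun' _ _ := rfl
  map_rel' _ _ h := h i

theorem Atom.holds_pi {I : Type u} {A : I → Type u} [∀ i, L.Structure (A i)]
    (α : Atom L (∀ i, A i)) : α.Holds ↔ ∀ i, (α.map (piEval (L := L) A i)).Holds := by
  cases α with
  | eq a b => exact funext_iff
  | rel R x => exact Iff.rfl

theorem QuasiIdentity.Sat.pi {q : QuasiIdentity L} {I : Type u} {A : I → Type u}
    [∀ i, L.Structure (A i)] (h : ∀ i, q.Sat (A i)) : q.Sat (∀ i, A i) := by
  intro v hv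
  rw [Atom.holds_pi]
  intro i
  rw [Atom.map_realize_hom]
  refine h i _ fun α hα => ?_
  rw [← Atom.map_realize_hom]
  exact (Atom.holds_pi _).1 (hv α hα) i

theorem Atom.holds_ultraproduct {I : Type u} {A : I → Type u} [∀ i, L.Structure (A i)]
    (U : Ultrafilter I) (v : ℕ → ∀ i, A i) (α : Atom L (Terms L)) :
    (α.map (Term.realize fun n => (v n : (U : Filter I).Product A))).Holds ↔
      ∀ᶠ i in (U : Filter I), (α.map (Term.realize fun n => v n i)).Holds := by
  cases α with
  | eq s t =>
    change Term.realize _ s = Term.realize _ t ↔ _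
    rw [Ultraproduct.term_realize_cast, Ultraproduct.term_realize_cast]
    exact Quotient.eq (r := (U : Filter I).productSetoid _)
  | rel R x =>
    change RelMap R (fun k => Term.realize _ (x k)) ↔ _
    simp only [Ultraproduct.term_realize_cast]
    exact relMap_quotient_mk' (ps := Ultraproduct.setoidPrestructure _ U) _ R
      (fun k i => Term.realize (fun n => v n i) (x k))

theorem QuasiIdentity.Sat.ultraproduct {q : QuasiIdentity L} {I : Type u} {A : I → Type u}
    [∀ i, L.Structure (A i)] (U : Ultrafilter I) (h : ∀ i, q.Sat (A i)) :
    q.Sat ((U : Filter I).Product A) := by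
  intro v hv
  obtain ⟨w, rfl⟩ : ∃ w : ℕ → ∀ i, A i, v = fun n => (w n : (U : Filter I).Product A) :=
    ⟨fun n => Quotient.out (v n), funext fun n => (Quotient.out_eq (v n)).symm⟩
  refine (Atom.holds_ultraproduct U w q.conclusion).2 ?_
  -- Each premise holds on a set in `U`; as the premises are finite in number, they hold together on
  -- a set in `U`.
  have hv' : ∀ᶠ i in (U : Filter I), ∀ α ∈ q.premises,
      (α.map (Term.realize fun n => w n i)).Holds :=
    (Filter.eventually_all_finite q.premises.finite_toSet).2 fun α hα =>
      (Atom.holds_ultraproduct U w α).1 (hv α hα)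
  exact hv'.mono fun i hi => h i _ hi

/-- The quasivariety of all models of a set of quasi-identities. -/
def modelClass (T : Set (QuasiIdentity L)) : Quasivariety L where
  carrier := {A | Nonempty A ∧ ∀ q ∈ T, q.Sat A}
  nonempty_of_mem _ hA := hA.1
  iso_mem := by
    rintro A ⟨⟨a⟩, hA⟩ B ⟨e⟩
    exact ⟨⟨e a⟩, fun q hq => (hA q hq).of_embedding e.symm.toEmbedding⟩
  sub_mem := fun A hA S hS => ⟨hS, fun q hq => (hA.2 q hq).of_embedding S.subtype⟩
  prod_mem := fun I A hA =>
    ⟨⟨fun i => (hA i).1.some⟩, fun q hq => QuasiIdentity.Sat.pi fun i => (hA i).2 q hq⟩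
  ultraproduct_mem := fun I U A hA =>
    ⟨⟨Quotient.mk _ fun i => (hA i).1.some⟩,
      fun q hq => QuasiIdentity.Sat.ultraproduct U fun i => (hA i).2 q hq⟩

/-! ### Generation by finite sets of atomic formulas -/

variable {K : Quasivariety L} {A : Type u} [L.Structure A] [Nonempty A]

theorem mem_conK {S : Set (Atom L A)} {α : Atom L A} (h : α ∈ S) :
    (conK S : KCon K A).1.Mem α :=
  conK_le.1 le_rfl α h

theorem conK_mono {S S' : Set (Atom L A)} (h : S ⊆ S') : (conK S : KCon K A) ≤ conK S' :=
  conK_le.2 fun _ hα => mem_conK (h hα)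

/-- The `K`-congruences generated by the finite subsets of a set of atomic formulas. -/
def finitelyGenerated (K : Quasivariety L) (S : Set (Atom L A)) : Set (KCon K A) :=
  {θ | ∃ Γ : Set (Atom L A), Γ.Finite ∧ Γ ⊆ S ∧ θ = conK Γ}

theorem finitelyGenerated_nonempty (S : Set (Atom L A)) : (finitelyGenerated K S).Nonempty :=
  ⟨_, ∅, Set.finite_empty, Set.empty_subset _, rfl⟩

theorem directedOn_finitelyGenerated (S : Set (Atom L A)) :
    DirectedOn (· ≤ ·) (finitelyGenerated K S) := by
  rintro _ ⟨Γ, hΓ, hS, rfl⟩ _ ⟨Δ, hΔ, hS', rfl⟩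
  exact ⟨_, ⟨Γ ∪ Δ, hΓ.union hΔ, Set.union_subset hS hS', rfl⟩,
    conK_mono Set.subset_union_left, conK_mono Set.subset_union_right⟩

theorem sSup_finitelyGenerated (S : Set (Atom L A)) :
    sSup (finitelyGenerated K S) = conK S := by
  refine le_antisymm (sSup_le ?_) (conK_le.2 fun α hα => ?_)
  · rintro _ ⟨Γ, -, hS, rfl⟩
    exact conK_mono hS
  · have hmem : conK {α} ∈ finitelyGenerated K S :=
      ⟨{α}, Set.finite_singleton α, Set.singleton_subset_iff.2 hα, rfl⟩
    exact KCon.le_iff.1 (le_sSup hmem) α (mem_conK rfl)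

/-- Finiteness comes from closure under ultraproducts: `conK S` is the directed join of the
congruences generated by finite subsets of `S`, and directed joins are unions. -/
theorem exists_finite_of_mem_conK {S : Set (Atom L A)} {α : Atom L A}
    (h : (conK S : KCon K A).1.Mem α) :
    ∃ Γ : Set (Atom L A), Γ.Finite ∧ Γ ⊆ S ∧ (conK Γ : KCon K A).1.Mem α := by
  rw [← sSup_finitelyGenerated, KCon.mem_sSup_of_directedOn (finitelyGenerated_nonempty S)
    (directedOn_finitelyGenerated S)] at h
  obtain ⟨_, ⟨Γ, h1, h2, rfl⟩, h3⟩ := h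
  exact ⟨Γ, h1, h2, h3⟩

theorem conK_atoms (θ : KCon K A) : conK θ.1.atoms = θ :=
  le_antisymm (conK_le.2 fun _ hα => hα) fun _ hα => mem_conK hα

theorem exists_finite_eq_conK {φ : KCon K A} (hφ : IsCompactElement φ) :
    ∃ Γ : Set (Atom L A), Γ.Finite ∧ φ = conK Γ := by
  rw [CompleteLattice.isCompactElement_iff_le_of_directed_sSup_le] at hφ
  obtain ⟨_, ⟨Γ, h1, h2, rfl⟩, h3⟩ := hφ _ (finitelyGenerated_nonempty φ.1.atoms)
    (directedOn_finitelyGenerated _) (by rw [sSup_finitelyGenerated, conK_atoms])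
  exact ⟨Γ, h1, le_antisymm h3 (conK_le.2 h2)⟩

theorem isCompactElement_conK_singleton (α : Atom L A) :
    IsCompactElement (conK {α} : KCon K A) := by
  rw [CompleteLattice.isCompactElement_iff_le_of_directed_sSup_le]
  intro s hne hd h
  obtain ⟨θ, hθ, hα⟩ := (KCon.mem_sSup_of_directedOn hne hd α).1 (conK_le.1 h α rfl)
  exact ⟨θ, hθ, conK_le.2 fun β hβ => by rwa [Set.mem_singleton_iff.1 hβ]⟩

theorem conK_union (S S' : Set (Atom L A)) :
    (conK (S ∪ S') : KCon K A) = conK S ⊔ conK S' := by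
  refine eq_of_forall_ge_iff fun θ => ?_
  simp only [sup_le_iff, conK_le, Set.mem_union, or_imp, forall_and]

theorem isCompactElement_conK {S : Set (Atom L A)} (hS : S.Finite) :
    IsCompactElement (conK S : KCon K A) := by
  induction S, hS using Set.Finite.induction_on with
  | empty =>
    have : (conK ∅ : KCon K A) = ⊥ := le_bot_iff.1 (conK_le.2 fun _ h => h.elim)
    exact this ▸ isCompactElement_bot
  | insert _ _ ih =>
    rw [Set.insert_eq, conK_union]
    exact isCompactElement_sup (isCompactElement_conK_singleton _) ih

/-! ### Mal'cev's theorem: quasivarieties are axiomatized by quasi-identities -/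

/-- The absolutely free structure on a set, with all relations empty. -/
def AbsFree (L : FirstOrder.Language.{u, u}) (X : Type u) : Type u := L.Term X

instance (X : Type u) : L.Structure (AbsFree L X) where
  funMap f x := Term.func f x
  RelMap _ _ := False

instance (X : Type u) [Nonempty X] : Nonempty (AbsFree L X) :=
  ⟨(Term.var (Classical.arbitrary X) : L.Term X)⟩

/-- The homomorphism from the absolutely free structure induced by an assignment. -/
def AbsFree.lift {X B : Type u} [L.Structure B] (v : X → B) : AbsFree L X →[L] B where
  toFun t := Term.realize v (t : L.Term X)
  map_fun' _ _ := rfl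
  map_rel' _ _ h := h.elim

/-- Prepares the renaming of arbitrary variables to variables in `ℕ`; countability of the support is
all that the renaming needs. -/
theorem exists_countable_realize_congr {X : Type u} (B : Type u) [L.Structure B] (t : L.Term X) :
    ∃ V : Set X, V.Countable ∧
      ∀ v w : X → B, Set.EqOn v w V → t.realize v = t.realize w := by
  induction t with
  | var x => exact ⟨{x}, Set.countable_singleton x, fun v w h => h rfl⟩
  | func f ts ih =>
    choose V hV h using ih
    refine ⟨⋃ i, V i, Set.countable_iUnion hV, fun v w hvw => ?_⟩
    exact congrArg (funMap f) (funext fun i =>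
      h i v w (hvw.mono (Set.subset_iUnion V i)))

theorem Atom.exists_countable_map_realize_congr {X : Type u} (B : Type u) [L.Structure B]
    (α : Atom L (L.Term X)) :
    ∃ V : Set X, V.Countable ∧
      ∀ v w : X → B, Set.EqOn v w V → α.map (Term.realize v) = α.map (Term.realize w) := by
  cases α with
  | eq s t =>
    obtain ⟨V, hV, hs⟩ := exists_countable_realize_congr B s
    obtain ⟨W, hW, ht⟩ := exists_countable_realize_congr B t
    refine ⟨V ∪ W, hV.union hW, fun v w h => ?_⟩
    exact congrArg₂ Atom.eq (hs v w (h.mono Set.subset_union_left))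
      (ht v w (h.mono Set.subset_union_right))
  | rel R x =>
    choose V hV h using fun i => exists_countable_realize_congr B (x i)
    refine ⟨⋃ i, V i, Set.countable_iUnion hV, fun v w hvw => ?_⟩
    exact congrArg (Atom.rel R) (funext fun i =>
      h i v w (hvw.mono (Set.subset_iUnion V i)))

theorem Atom.map_relabel_map_realize {X B : Type u} [L.Structure B] (g : X → ℕ) (w : ℕ → B)
    (α : Atom L (L.Term X)) :
    (α.map (Term.relabel g)).map (Term.realize w) = α.map (Term.realize (w ∘ g)) := by
  rw [Atom.map_map]
  congr 1
  funext t
  exact Term.realize_relabel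

/-- An implication between atomic formulas in arbitrary variables that holds throughout `K` holds
in every model of the theory of `K`. -/
theorem holds_of_models_theory {X B : Type u} [Nonempty X] [L.Structure B]
    (hB : ∀ q ∈ K.theory, q.Sat B) (v : X → B)
    {Γ : Set (Atom L (L.Term X))} (hΓ : Γ.Finite) {β : Atom L (L.Term X)}
    (hK : ∀ C ∈ K.carrier, ∀ w : X → C, (∀ α ∈ Γ, (α.map (Term.realize w)).Holds) →
      (β.map (Term.realize w)).Holds)
    (hv : ∀ α ∈ Γ, (α.map (Term.realize v)).Holds) : (β.map (Term.realize v)).Holds := by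
  choose V hV hcongr using fun α : Atom L (L.Term X) =>
    Atom.exists_countable_map_realize_congr B α
  -- `k` enumerates all variables that matter. The extra element keeps the set nonempty when no
  -- variable occurs, so that it is the range of a sequence.
  obtain ⟨k, hk⟩ : ∃ k : ℕ → X, insert (Classical.arbitrary X) (⋃ α ∈ insert β Γ, V α) =
      Set.range k :=
    (((hΓ.insert β).countable.biUnion fun α _ => hV α).insert _).exists_eq_range
      (Set.insert_nonempty _ _)
  let g : X → ℕ := Function.invFun k
  -- The renaming `g` is undone by `k` on the relevant variables; its values elsewhere do not affect
  -- these formulas.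
  have hkg : ∀ α ∈ insert β Γ,
      α.map (Term.realize ((v ∘ k) ∘ g)) = α.map (Term.realize v) := by
    refine fun α hα => hcongr α _ _ fun x hx => congrArg v (Function.invFun_eq ?_)
    change x ∈ Set.range k
    rw [← hk]
    exact Set.mem_insert_of_mem _ (Set.mem_biUnion hα hx)
  let q : QuasiIdentity L :=
    ⟨hΓ.toFinset.toList.map (Atom.map (Term.relabel g)), β.map (Term.relabel g)⟩
  have hq : q ∈ K.theory := by
    intro C hC w hw
    change ((β.map (Term.relabel g)).map (Term.realize w)).Holds
    rw [Atom.map_relabel_map_realize]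
    refine hK C hC _ fun α hα => ?_
    rw [← Atom.map_relabel_map_realize]
    exact hw _ (List.mem_map_of_mem (by simpa using hα))
  have hqB := hB q hq (v ∘ k) fun α hα => by
    obtain ⟨γ, hγ, rfl⟩ := List.mem_map.1 hα
    have hγ : γ ∈ Γ := by simpa using hγ
    rw [Atom.map_relabel_map_realize, hkg γ (Set.mem_insert_of_mem β hγ)]
    exact hv γ hγ
  change ((β.map (Term.relabel g)).map (Term.realize (v ∘ k))).Holds at hqB
  rwa [Atom.map_relabel_map_realize, hkg β (Set.mem_insert β Γ)] at hqB

/-- The hard half of Mal'cev's theorem. `A` is the quotient of the absolutely free structure on its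
own elements by the kernel of evaluation, so it suffices that this kernel is a `K`-congruence. It
equals the `K`-congruence it generates: an atomic formula of the latter follows throughout `K` from
finitely many atomic formulas of the kernel, hence also follows from them in `A`. -/
theorem mem_of_models_theory (hA : ∀ q ∈ K.theory, q.Sat A) :
    (Bundled.of A : Bundled.{u} L.Structure) ∈ K.carrier := by
  let h : AbsFree L A →[L] A := AbsFree.lift id
  let θ : KCon K (AbsFree L A) := conK (StrCon.ker h).atoms
  have hθ : ∀ β, θ.1.Mem β → (StrCon.ker h).Mem β := by
    intro β hβ
    obtain ⟨Γ, hΓ, hS, hβ⟩ := exists_finite_of_mem_conK hβ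
    refine (StrCon.mem_ker h β).2 (holds_of_models_theory hA id hΓ (fun B hB w hw => ?_)
      fun α hα => (StrCon.mem_ker h α).1 (hS hα))
    have : Nonempty B := K.nonempty_of_mem B hB
    exact (StrCon.mem_ker (AbsFree.lift w) β).1 (KCon.le_iff.1
      (conK_le.2 fun α hα => (StrCon.mem_ker (AbsFree.lift w) α).2 (hw α hα) :
        conK Γ ≤ KCon.ker (K := K) hB (AbsFree.lift w)) β hβ)
  have heq : θ.1 = StrCon.ker h :=
    le_antisymm (StrCon.le_iff.2 hθ) (StrCon.le_iff.2 fun β hβ => mem_conK hβ)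
  have hmem := θ.2
  rw [heq] at hmem
  let e := StrCon.kerEmbedding h
  have he : Function.Surjective e := fun a =>
    ⟨StrCon.proj _ (Term.var a : L.Term A),
      (StrCon.ker h).eqv_out (Term.var a : L.Term A)⟩
  refine K.iso_mem _ hmem _ ⟨⟨Equiv.ofBijective e ⟨e.injective, he⟩, ?_, ?_⟩⟩
  · intro n f x
    exact e.map_fun f x
  · intro n R x
    exact e.map_rel R x

theorem modelClass_theory (K : Quasivariety L) : modelClass K.theory = K := by
  refine Quasivariety.carrier_injective (Set.ext fun A => ⟨?_, fun hA => ?_⟩)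
  · rintro ⟨_, hA⟩
    exact mem_of_models_theory hA
  · exact ⟨K.nonempty_of_mem A hA, fun q hq => hq A hA⟩

end QuasiIdentities

section Correspondence

variable {L : FirstOrder.Language.{u, u}} {K : Quasivariety L}

/-! ### Quasi-identities and compact congruences of the free structure -/

/-- The `K`-congruence of the free structure generated by a list of atomic formulas. -/
noncomputable def listCon (K : Quasivariety L) (Γ : List (Atom L (Terms L))) :
    CompactKCon K (FreeStr K) :=
  ⟨conK (Atom.map (Term.realize (FreeStr.gen K)) '' {α | α ∈ Γ}),
    isCompactElement_conK (Γ.finite_toSet.image _)⟩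

theorem listCon_le {Γ : List (Atom L (Terms L))} {χ : KCon K (FreeStr K)} :
    (listCon K Γ).1 ≤ χ ↔ ∀ α ∈ Γ, χ.1.Mem (α.map (Term.realize (FreeStr.gen K))) := by
  refine conK_le.trans ?_
  rw [Set.forall_mem_image]
  rfl

/-- The dictionary between the operators and semantics: `ε` acts as the assignment sending variable
`n` to the class of `ε (gen n)`. -/
theorem hat_listCon_le {Γ : List (Atom L (Terms L))} {χ : KCon K (FreeStr K)}
    {ε : FreeStr K →[L] FreeStr K} :
    hat ε (listCon K Γ).1 ≤ χ ↔
      ∀ α ∈ Γ, (α.map (Term.realize fun n => χ.1.proj (ε (FreeStr.gen K n)))).Holds := by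
  rw [hat_le, listCon_le]
  refine forall₂_congr fun α _ => ?_
  rw [KCon.mem_comap, ← StrCon.holds_proj, Atom.map_realize_hom]
  exact (congrArg Atom.Holds
    (Atom.map_realize_hom χ.1.projHom (ε ∘ FreeStr.gen K) α)).to_iff

theorem listCon_mono {Γ Δ : List (Atom L (Terms L))} (h : Γ ⊆ Δ) :
    listCon K Γ ≤ listCon K Δ :=
  listCon_le.2 fun α hα => listCon_le.1 le_rfl α (h hα)

theorem realize_gen_surjective (K : Quasivariety L) :
    Function.Surjective (Term.realize (L := L) (FreeStr.gen K)) := by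
  have key : ∀ t : L.Term ℕ, (StrCon.proj _ t : FreeStr K) = Term.realize (FreeStr.gen K) t := by
    intro t
    induction t with
    | var i => rfl
    | func f ts ih =>
      refine (StrCon.funMap_proj (⊥ : KCon K (TermStr L)).1 f ts).symm.trans ?_
      exact congrArg (funMap f) (funext ih)
  intro a
  exact ⟨Quotient.out a, (key _).symm.trans (StrCon.proj_out _ a)⟩

theorem Atom.map_surjective {A B : Type u} {f : A → B} (hf : Function.Surjective f) :
    Function.Surjective (Atom.map f : Atom L A → Atom L B) := by
  rintro (⟨a, b⟩ | ⟨R, x⟩)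
  · obtain ⟨a, rfl⟩ := hf a
    obtain ⟨b, rfl⟩ := hf b
    exact ⟨.eq a b, rfl⟩
  · exact ⟨.rel R fun i => Function.surjInv hf (x i),
      congrArg (Atom.rel R) (funext fun i => Function.surjInv_eq hf (x i))⟩

/-- Compact congruences are finitely generated, and each generating atomic formula lifts to terms
because the generators generate `F`. -/
theorem listCon_surjective : Function.Surjective (listCon K) := by
  rintro ⟨φ, hφ⟩
  obtain ⟨S, hS, rfl⟩ := exists_finite_eq_conK hφ
  let g : Atom L (FreeStr K) → Atom L (Terms L) :=
    Function.surjInv (Atom.map_surjective (realize_gen_surjective K))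
  refine ⟨hS.toFinset.toList.map g, Subtype.ext (eq_of_forall_ge_iff fun χ => ?_)⟩
  rw [listCon_le, conK_le]
  simp only [List.mem_map, Finset.mem_toList, Set.Finite.mem_toFinset, forall_exists_index,
    and_imp, forall_apply_eq_imp_iff₂]
  refine forall₂_congr fun α _ => ?_
  rw [Function.surjInv_eq (Atom.map_surjective (realize_gen_surjective K)) α]

theorem exists_endomorphism (σ : ℕ → FreeStr K) :
    ∃ ε : FreeStr K →[L] FreeStr K, ∀ i, ε (FreeStr.gen K i) = σ i :=
  (freeStr_existsUnique K (freeStr_mem K) σ).exists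

/-- Every assignment into `F/χ` is induced by an endomorphism: choose representatives in `F` and
extend by freeness. -/
theorem sat_quot_iff {q : QuasiIdentity L} {χ : KCon K (FreeStr K)} :
    q.Sat χ.1.Quot ↔ ∀ ε : FreeStr K →[L] FreeStr K,
      hat ε (listCon K q.premises).1 ≤ χ → hat ε (listCon K [q.conclusion]).1 ≤ χ := by
  simp only [hat_listCon_le, List.mem_singleton, forall_eq]
  refine ⟨fun h ε => h _, fun h v => ?_⟩
  obtain ⟨ε, hε⟩ := exists_endomorphism (K := K) fun n => Quotient.out (v n)
  have hv : v = fun n => χ.1.proj (ε (FreeStr.gen K n)) :=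
    funext fun n => by rw [hε, χ.1.proj_out]
  rw [hv]
  exact h ε

theorem hat_id (φ : KCon K (FreeStr K)) : hat (Hom.id L _) φ = φ := by
  refine eq_of_forall_ge_iff fun χ => hat_le.trans ?_
  rw [KCon.le_iff, KCon.le_iff]
  refine forall₂_congr fun α _ => ?_
  rw [KCon.mem_comap]
  cases α <;> rfl

/-- The embedding of the quotient by an inverse image of a congruence. -/
noncomputable def comapEmbedding (ε : FreeStr K →[L] FreeStr K) (χ : KCon K (FreeStr K)) :
    (χ.comap ε).1.Quot ↪[L] χ.1.Quot :=
  StrCon.kerEmbedding (χ.1.projHom.comp ε)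

/-! ### Congruences of semilattices with operators -/

namespace OpCon

variable {S ι : Type u} [SemilatticeSup S] [OrderBot S] {op : ι → SupBotHom S S} (θ : OpCon op)

theorem le_iff {θ θ' : OpCon op} : θ ≤ θ' ↔ ∀ a b, θ.eqv a b → θ'.eqv a b :=
  ⟨fun h _ _ hab => h hab, fun h _ _ hab => h _ _ hab⟩

theorem eqv_of_le_of_le {a b c : S} (hab : θ.eqv a b) (hac : a ≤ c) (hcb : c ≤ b) :
    θ.eqv c b := by
  have := θ.sup_compat _ _ _ _ (θ.eqv.refl c) hab
  rwa [sup_eq_left.2 hac, sup_eq_right.2 hcb] at this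

/-- Read `θ.eqv (b ⊔ a) a` as "`b ≤ a` modulo `θ`". This lemma and the next four show that it
behaves as a preorder with joins, whose symmetric part is `θ`. -/
theorem sup_eqv_left {a b : S} (hab : θ.eqv a b) : θ.eqv (b ⊔ a) a := by
  have := θ.sup_compat _ _ _ _ (θ.eqv.symm hab) (θ.eqv.refl a)
  rwa [sup_idem] at this

theorem sup_eqv_of_le {a b c : S} (hbc : b ≤ c) (h : θ.eqv (c ⊔ a) a) : θ.eqv (b ⊔ a) a :=
  θ.eqv.trans (θ.eqv_of_le_of_le (θ.eqv.symm h) le_sup_right (sup_le_sup_right hbc a)) h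

theorem sup_eqv_trans {a b c : S} (hbc : θ.eqv (c ⊔ b) b) (hab : θ.eqv (b ⊔ a) a) :
    θ.eqv (c ⊔ a) a := by
  refine θ.sup_eqv_of_le (c := c ⊔ b) le_sup_left ?_
  exact θ.eqv.trans (θ.sup_compat _ _ _ _ hbc (θ.eqv.refl a)) hab

theorem sup_sup_eqv {a b c : S} (hb : θ.eqv (b ⊔ a) a) (hc : θ.eqv (c ⊔ a) a) :
    θ.eqv (b ⊔ c ⊔ a) a := by
  have := θ.sup_compat _ _ _ _ hb hc
  rwa [sup_idem, sup_sup_sup_comm, sup_idem] at this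

theorem eqv_of_sup_eqv {a b : S} (hb : θ.eqv (b ⊔ a) a) (ha : θ.eqv (a ⊔ b) b) :
    θ.eqv a b := by
  rw [sup_comm] at ha
  exact θ.eqv.trans (θ.eqv.symm hb) ha

end OpCon

/-! ### The closure of a compact congruence under a congruence of `S` -/

/-- The compact congruences forced below `φ` by `θ`. -/
def forced (θ : ConS K) (φ : CompactKCon K (FreeStr K)) : Set (KCon K (FreeStr K)) :=
  Subtype.val '' {ψ : CompactKCon K (FreeStr K) | θ.eqv (ψ ⊔ φ) φ}

theorem self_mem_forced (θ : ConS K) (φ : CompactKCon K (FreeStr K)) : φ.1 ∈ forced θ φ :=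
  ⟨φ, show θ.eqv (φ ⊔ φ) φ by rw [sup_idem], rfl⟩

theorem directedOn_forced (θ : ConS K) (φ : CompactKCon K (FreeStr K)) :
    DirectedOn (· ≤ ·) (forced θ φ) := by
  rintro _ ⟨a, ha, rfl⟩ _ ⟨b, hb, rfl⟩
  exact ⟨_, ⟨a ⊔ b, θ.sup_sup_eqv ha hb, rfl⟩, (le_sup_left : a ≤ a ⊔ b),
    (le_sup_right : b ≤ a ⊔ b)⟩

/-- The `K`-congruence generated by the compact congruences forced below `φ` by `θ`. -/
noncomputable def closure (θ : ConS K) (φ : CompactKCon K (FreeStr K)) : KCon K (FreeStr K) :=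
  sSup (forced θ φ)

/-- A compact `ψ` below the directed join lies below one forced congruence, and the forced compact
congruences are closed downwards. -/
theorem le_closure_iff {θ : ConS K} {φ ψ : CompactKCon K (FreeStr K)} :
    ψ.1 ≤ closure θ φ ↔ θ.eqv (ψ ⊔ φ) φ := by
  refine ⟨fun h => ?_, fun h => le_sSup ⟨ψ, h, rfl⟩⟩
  obtain ⟨_, ⟨χ, hχ, rfl⟩, hle⟩ :=
    (CompleteLattice.isCompactElement_iff_le_of_directed_sSup_le _ _).1 ψ.2 _
      ⟨_, self_mem_forced θ φ⟩ (directedOn_forced θ φ) h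
  exact θ.sup_eqv_of_le (show ψ ≤ χ from hle) hχ

/-! ### The correspondence between theories and congruences -/

/-- The quasi-identities encoded by a congruence of `S`. -/
def theoryOf (θ : ConS K) : Set (QuasiIdentity L) :=
  {q | θ.eqv (listCon K [q.conclusion] ⊔ listCon K q.premises) (listCon K q.premises)}

/-- Compatibility of `θ` with `ε̂` carries "conclusion below premises modulo `θ`" to every
substitution instance; transitivity does the rest. -/
theorem sat_closure {θ : ConS K} (φ : CompactKCon K (FreeStr K)) {q : QuasiIdentity L}
    (hq : q ∈ theoryOf θ) : q.Sat (closure θ φ).1.Quot := by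
  rw [sat_quot_iff]
  intro ε h
  have h' := (le_closure_iff (ψ := hatOp ε (listCon K q.premises))).1 h
  refine (le_closure_iff (ψ := hatOp ε (listCon K [q.conclusion]))).2 (θ.sup_eqv_trans ?_ h')
  have := θ.op_compat ε _ _ hq
  rwa [map_sup] at this

/-- The quotient by the closure of the premises is a canonical test model: the generators satisfy
the premises there, so the conclusion must be forced. -/
theorem mem_theoryOf_of_sat_closure {θ : ConS K} {q : QuasiIdentity L}
    (h : q.Sat (closure θ (listCon K q.premises)).1.Quot) : q ∈ theoryOf θ := by
  have := sat_quot_iff.1 h (Hom.id L _)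
  rw [hat_id, hat_id] at this
  exact le_closure_iff.1 (this (le_sSup (self_mem_forced θ _)))

theorem isQuasiEquationalTheory_theoryOf (θ : ConS K) :
    IsQuasiEquationalTheory (theoryOf θ) := fun q hq =>
  mem_theoryOf_of_sat_closure (hq (Bundled.of (closure θ (listCon K q.premises)).1.Quot)
    ⟨StrCon.proj _ (FreeStr.gen K 0)⟩ fun _ hp => sat_closure _ hp)

theorem theory_subset_theoryOf (θ : ConS K) : K.theory ⊆ theoryOf θ := fun _ hq =>
  mem_theoryOf_of_sat_closure (hq _ (closure θ _).2)

/-- The congruence of `S` that identifies compact congruences contained in the same congruences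
whose quotients are models of `T`. -/
def congruenceOf (K : Quasivariety L) (T : Set (QuasiIdentity L)) : ConS K where
  eqv :=
    { r := fun φ ψ => ∀ χ : KCon K (FreeStr K), (∀ q ∈ T, q.Sat χ.1.Quot) → (φ.1 ≤ χ ↔ ψ.1 ≤ χ)
      iseqv := ⟨fun _ _ _ => Iff.rfl, fun h χ hχ => (h χ hχ).symm,
        fun h h' χ hχ => (h χ hχ).trans (h' χ hχ)⟩ }
  sup_compat a b _ _ hab hcd χ hχ :=
    (sup_le_iff (a := a.1)).trans ((and_congr (hab χ hχ) (hcd χ hχ)).trans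
      (sup_le_iff (a := b.1)).symm)
  op_compat ε _ _ hab χ hχ :=
    -- The preimage of `χ` is again an admissible test congruence, since its quotient embeds into
    -- `F/χ`.
    hat_le.trans ((hab (χ.comap ε) fun q hq =>
      (hχ q hq).of_embedding (comapEmbedding ε χ)).trans hat_le.symm)

theorem congruenceOf_mono {T T' : Set (QuasiIdentity L)} (h : T ⊆ T') :
    congruenceOf K T ≤ congruenceOf K T' :=
  OpCon.le_iff.2 fun _ _ hφ χ hχ => hφ χ fun q hq => hχ q (h hq)

theorem theoryOf_mono {θ θ' : ConS K} (h : θ ≤ θ') : theoryOf θ ⊆ theoryOf θ' :=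
  fun _ hq => OpCon.le_iff.1 h _ _ hq

/-- Quotients of `F` suffice to test consequences of `T`: a model `A` of `T` is in `K` by Mal'cev's
theorem, so an assignment into it extends to a homomorphism from `F`. The quotient by its kernel
embeds into `A`, hence is a model of `T`. -/
theorem theoryOf_congruenceOf {T : Set (QuasiIdentity L)} (hT : IsQuasiEquationalTheory T)
    (hK : K.theory ⊆ T) : theoryOf (congruenceOf K T) = T := by
  refine Set.Subset.antisymm (fun q hq => hT q fun A hA hsat v hv => ?_) fun q hq χ hχ => ?_
  · have hAK : A ∈ K.carrier := mem_of_models_theory fun p hp => hsat p (hK hp)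
    obtain ⟨h, hh⟩ := (freeStr_existsUnique K hAK v).exists
    have hv' : v = h ∘ FreeStr.gen K := funext fun i => (hh i).symm
    have hmem : ∀ α : Atom L (Terms L), (KCon.ker hAK h).1.Mem
        (α.map (Term.realize (FreeStr.gen K))) ↔ (α.map (Term.realize v)).Holds := fun α => by
      rw [hv', ← Atom.map_realize_hom]
      exact StrCon.mem_ker h _
    have := (hq (KCon.ker hAK h) fun p hp =>
      (hsat p hp).of_embedding (StrCon.kerEmbedding h)).2
        (listCon_le.2 fun α hα => (hmem α).2 (hv α hα))
    exact (hmem _).1 (listCon_le.1 ((le_sup_left (a := (listCon K [q.conclusion]).1)).trans this)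
      _ (List.mem_singleton_self _))
  · have := sat_quot_iff.1 (hχ q hq) (Hom.id L _)
    rw [hat_id, hat_id] at this
    exact (sup_le_iff (a := (listCon K [q.conclusion]).1)).trans (and_iff_right_of_imp this)

/-- Testing against the closures of `φ` and of `ψ` puts each below the other modulo `θ`. -/
theorem congruenceOf_theoryOf_le (θ : ConS K) : congruenceOf K (theoryOf θ) ≤ θ := by
  refine OpCon.le_iff.2 fun φ ψ h => θ.eqv_of_sup_eqv ?_ ?_
  · exact le_closure_iff.1 ((h _ fun _ => sat_closure φ).1 (le_sSup (self_mem_forced θ φ)))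
  · exact le_closure_iff.1 ((h _ fun _ => sat_closure ψ).2 (le_sSup (self_mem_forced θ ψ)))

/-- A conclusion is a single atomic formula, so `ψ` is split into its generators `β`; each gives a
quasi-identity `Γ ⟹ β` in the theory of `θ`. -/
theorem le_of_sup_eqv {θ : ConS K} {φ ψ : CompactKCon K (FreeStr K)} (h : θ.eqv (ψ ⊔ φ) φ)
    {χ : KCon K (FreeStr K)} (hχ : ∀ q ∈ theoryOf θ, q.Sat χ.1.Quot) (hφ : φ.1 ≤ χ) :
    ψ.1 ≤ χ := by
  obtain ⟨Γ, rfl⟩ := listCon_surjective φ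
  obtain ⟨Δ, rfl⟩ := listCon_surjective ψ
  refine listCon_le.2 fun β hβ => ?_
  have hq : (⟨Γ, β⟩ : QuasiIdentity L) ∈ theoryOf θ :=
    θ.sup_eqv_of_le (listCon_mono (List.cons_subset.2 ⟨hβ, List.nil_subset Δ⟩)) h
  have := sat_quot_iff.1 (hχ _ hq) (Hom.id L _)
  rw [hat_id, hat_id] at this
  exact listCon_le.1 (this hφ) β (List.mem_singleton_self β)

theorem congruenceOf_theoryOf (θ : ConS K) : congruenceOf K (theoryOf θ) = θ :=
  le_antisymm (congruenceOf_theoryOf_le θ) (OpCon.le_iff.2 fun _ _ h _ hχ =>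
    ⟨le_of_sup_eqv (θ.sup_eqv_left h) hχ, le_of_sup_eqv (θ.sup_eqv_left (θ.eqv.symm h)) hχ⟩)

/-- Quasi-equational theories containing the theory of `K` correspond to the congruences of `S`. -/
noncomputable def theoryEquivCongruence (K : Quasivariety L) : QTh K ≃o ConS K :=
  Equiv.toOrderIso
    { toFun := fun T => congruenceOf K T.1
      invFun := fun θ =>
        ⟨theoryOf θ, isQuasiEquationalTheory_theoryOf θ, theory_subset_theoryOf θ⟩
      left_inv := fun T => Subtype.ext (theoryOf_congruenceOf T.2.1 T.2.2)
      right_inv := congruenceOf_theoryOf }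
    (fun _ _ h => congruenceOf_mono h) (fun _ _ h => theoryOf_mono h)

/-! ### Duality between subquasivarieties and theories -/

theorem isQuasiEquationalTheory_theory (Q : Quasivariety L) :
    IsQuasiEquationalTheory Q.theory :=
  fun _ hq A hA => hq A (Q.nonempty_of_mem A hA) fun _ hp => hp A hA

theorem theory_anti {Q Q' : Quasivariety L} (h : Q ≤ Q') : Q'.theory ⊆ Q.theory :=
  fun _ hq A hA => hq A (h hA)

theorem modelClass_anti {T T' : Set (QuasiIdentity L)} (h : T ⊆ T') :
    modelClass T' ≤ modelClass T :=
  fun _ hA => ⟨hA.1, fun q hq => hA.2 q (h hq)⟩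

theorem theory_modelClass {T : Set (QuasiIdentity L)} (hT : IsQuasiEquationalTheory T) :
    (modelClass T).theory = T :=
  Set.Subset.antisymm (fun q hq => hT q fun A hA hsat => hq A ⟨hA, hsat⟩)
    fun q hq _ hA => hA.2 q hq

/-- Subquasivarieties of `K` correspond, dually, to the theories containing the theory of `K`. -/
def subquasivarietyEquivTheory (K : Quasivariety L) : Lq K ≃o (QTh K)ᵒᵈ :=
  Equiv.toOrderIso
    { toFun := fun Q => OrderDual.toDual
        ⟨Q.1.theory, isQuasiEquationalTheory_theory Q.1, theory_anti Q.2⟩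
      invFun := fun T => ⟨modelClass (OrderDual.ofDual T).1,
        (modelClass_anti (OrderDual.ofDual T).2.2).trans (modelClass_theory K).le⟩
      left_inv := fun Q => Subtype.ext (modelClass_theory Q.1)
      right_inv := fun T => Subtype.ext (theory_modelClass (OrderDual.ofDual T).2.1) }
    (fun _ _ h => theory_anti h) (fun _ _ h => modelClass_anti h)

end Correspondence

end StructQV

theorem theorem3p2 {L : FirstOrder.Language.{u, u}} (K : StructQV.Quasivariety L) :
    Nonempty (StructQV.Lq K ≃o (StructQV.ConS K)ᵒᵈ) ∧
      Nonempty (StructQV.QTh K ≃o StructQV.ConS K) :=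
  ⟨⟨(StructQV.subquasivarietyEquivTheory K).trans (StructQV.theoryEquivCongruence K).dual⟩,
    ⟨StructQV.theoryEquivCongruence K⟩⟩
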